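/- **Theorem 1.2.** Let $N\in\mathbb N$, $0<\mu<N$ and $p,q\ge 1$ be real, and consider the equation $$-\Delta u(x)=\Big(\int_{\mathbb R^N\setminus\{0\}}\frac{|u(y)|^p}{|x-y|^\mu}\,dy\Big)|u(x)|^q,\qquad x\in\mathbb R^N\setminus\{0\}.\tag{1}$$ For $0<\alpha<N$ put $\gamma(\alpha)=2^{\alpha}\pi^{N/2}\,\Gamma(\alpha/2)\big/\Gamma\big(\tfrac{N-\alpha}{2}\big)$, where $\Gamma$ is Euler's Gamma function. Let $$s=\frac{N-\mu+2}{p+q-1}$$ and suppose that $0<sp<N$, $2-N<s(q-1)<2$ and $s<N-2$. Then $s>0$, $$K:=\frac{s(N-2-s)\,\gamma(N-2+s(q-1))}{\gamma(N-\mu)\,\gamma(N-sp)}>0,$$ and, with $A>0$ determined by $A^{p+q-1}=K$, the function $u(x)=A|x|^{-s}$ on $\mathbb R^N\setminus\{0\}$ is a radially symmetric, positive, singular solution of (1). Here singular means that $u(x)\to+\infty$ as $x\to0$; solution means that for every $x\ne0$ the integral in (1) converges, that $u\in C^2(\mathbb R^N\setminus\{0\})$ satisfies (1) at every $x\neq0$,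 and that $u$ is also a weak solution: $u\in C(\mathbb R^N\setminus\{0\})\cap H^1_{\rm loc}(\mathbb R^N\setminus\{0\})$, the right-hand side of (1) is locally integrable on $\mathbb R^N\setminus\{0\}$, and $$\int_{\mathbb R^N\setminus\{0\}}\nabla u\cdot\nabla\varphi\,dx=\int_{\mathbb R^N\setminus\{0\}}\Big(\int_{\mathbb R^N\setminus\{0\}}\frac{|u(y)|^p}{|x-y|^\mu}\,dy\Big)|u(x)|^q\varphi(x)\,dx\qquad\text{for all }\varphi\in C_c^\infty(\mathbb R^N\setminus\{0\}).$$ -/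

import Mathlib

open MeasureTheory Filter Topology
open scoped ContDiff Laplacian Gradient

/-- The normalising constant of the Riesz potential of order `α` on `ℝ^N`,
`γ(α) = 2^α π^{N/2} Γ(α/2) / Γ((N-α)/2)`. -/
noncomputable def rieszGamma (N : ℕ) (α : ℝ) : ℝ :=
  (2 : ℝ) ^ α * Real.pi ^ ((N : ℝ) / 2) * Real.Gamma (α / 2) / Real.Gamma (((N : ℝ) - α) / 2)

/-- The nonlocal term `∫_{ℝ^N ∖ {0}} |u(y)|^p / |x - y|^μ dy`. -/
noncomputable def nonlocalTerm (N : ℕ) (μ p : ℝ) (u : EuclideanSpace ℝ (Fin N) → ℝ)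
    (x : EuclideanSpace ℝ (Fin N)) : ℝ :=
  ∫ y in ({0}ᶜ : Set (EuclideanSpace ℝ (Fin N))), |u y| ^ p / ‖x - y‖ ^ μ

/-- The integral defining the nonlocal term converges at every point of `ℝ^N ∖ {0}`. -/
def NonlocalTermConverges (N : ℕ) (μ p : ℝ) (u : EuclideanSpace ℝ (Fin N) → ℝ) : Prop :=
  ∀ x : EuclideanSpace ℝ (Fin N), x ≠ 0 →
    IntegrableOn (fun y => |u y| ^ p / ‖x - y‖ ^ μ) ({0}ᶜ : Set (EuclideanSpace ℝ (Fin N)))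

/-- `u` is a classical solution of
`-Δu = (∫_{ℝ^N ∖ {0}} |u(y)|^p / |x - y|^μ dy) |u(x)|^q` in `ℝ^N ∖ {0}`. -/
structure IsClassicalSolution (N : ℕ) (μ p q : ℝ) (u : EuclideanSpace ℝ (Fin N) → ℝ) :
    Prop where
  contDiffOn : ContDiffOn ℝ 2 u {0}ᶜ
  converges : NonlocalTermConverges N μ p u
  equation : ∀ x : EuclideanSpace ℝ (Fin N), x ≠ 0 →
    -(Δ u x) = nonlocalTerm N μ p u x * |u x| ^ q

/-- Test functions on `ℝ^N ∖ {0}`: the elements of `C_c^∞(ℝ^N ∖ {0})`. -/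
structure IsTestFunction (N : ℕ) (φ : EuclideanSpace ℝ (Fin N) → ℝ) : Prop where
  contDiff : ContDiff ℝ ∞ φ
  hasCompactSupport : HasCompactSupport φ
  tsupport_subset : tsupport φ ⊆ {0}ᶜ

/-- `G` is the weak gradient of `u` on `ℝ^N ∖ {0}`. -/
structure IsWeakGradient (N : ℕ) (u : EuclideanSpace ℝ (Fin N) → ℝ)
    (G : EuclideanSpace ℝ (Fin N) → EuclideanSpace ℝ (Fin N)) : Prop where
  locallyIntegrableOn : LocallyIntegrableOn u {0}ᶜ
  locallyIntegrableOn_grad : LocallyIntegrableOn G {0}ᶜ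
  integral_eq : ∀ φ : EuclideanSpace ℝ (Fin N) → ℝ, IsTestFunction N φ →
    ∫ x in ({0}ᶜ : Set (EuclideanSpace ℝ (Fin N))), u x • ∇ φ x =
      -∫ x in ({0}ᶜ : Set (EuclideanSpace ℝ (Fin N))), φ x • G x

/-- `u` is a weak solution, continuous and of class `H^1_loc`, of
`-Δu = (∫_{ℝ^N ∖ {0}} |u(y)|^p / |x - y|^μ dy) |u(x)|^q` in `ℝ^N ∖ {0}`. -/
def IsWeakSolution (N : ℕ) (μ p q : ℝ) (u : EuclideanSpace ℝ (Fin N) → ℝ) : Prop :=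
  ContinuousOn u {0}ᶜ ∧
  NonlocalTermConverges N μ p u ∧
  LocallyIntegrableOn (fun x => nonlocalTerm N μ p u x * |u x| ^ q) {0}ᶜ ∧
  ∃ G : EuclideanSpace ℝ (Fin N) → EuclideanSpace ℝ (Fin N),
    IsWeakGradient N u G ∧
    LocallyIntegrableOn (fun x => ‖G x‖ ^ 2) {0}ᶜ ∧
    ∀ φ : EuclideanSpace ℝ (Fin N) → ℝ, IsTestFunction N φ →
      ∫ x in ({0}ᶜ : Set (EuclideanSpace ℝ (Fin N))), inner ℝ (G x) (∇ φ x) =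
        ∫ x in ({0}ᶜ : Set (EuclideanSpace ℝ (Fin N))),
          nonlocalTerm N μ p u x * |u x| ^ q * φ x

/-- `u` is radially symmetric on `ℝ^N ∖ {0}`. -/
def IsRadial (N : ℕ) (u : EuclideanSpace ℝ (Fin N) → ℝ) : Prop :=
  ∀ x y : EuclideanSpace ℝ (Fin N), x ≠ 0 → y ≠ 0 → ‖x‖ = ‖y‖ → u x = u y

/-! Both sides of the equation send powers of $|x|$ to powers of $|x|$, so only an exponent and a
constant have to match. Off the origin, $-\Delta|x|^{-s}=s(N-2-s)|x|^{-s-2}$. The nonlocal term is a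
convolution of the Riesz kernels $|x|^{\alpha-N}$ and $|x|^{\beta-N}$ with $\alpha=N-\mu$,
$\beta=N-sp$; by `riesz_composition` it is $\gamma(\alpha)\gamma(\beta)/\gamma(\alpha+\beta)$ times
$|x|^{\alpha+\beta-N}$. The choice of $s$ makes the exponents agree and gives
$\alpha+\beta=N-2+s(q-1)$; the constants then agree exactly when $A^{p+q-1}=K$.

The composition formula comes from writing each power as a Gamma integral of Gaussians, convolving
the Gaussians, and evaluating the remaining double integral by Gamma and Beta integrals. With values
in `ENNReal`, Tonelli needs no prior integrability, and convergence follows from the finite value.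

A classical solution is weak by integration by parts, as test functions vanish near the origin. -/

/-! ### Gamma, Gaussian and Beta integrals; convolution of powers -/

theorem lintegral_rpow_mul_exp_neg_mul_Ioi {a r : ℝ} (ha : 0 < a) (hr : 0 < r) :
    ∫⁻ t in Set.Ioi (0 : ℝ), ENNReal.ofReal (t ^ (a - 1) * Real.exp (-(r * t))) =
      ENNReal.ofReal ((1 / r) ^ a * Real.Gamma a) := by
  rw [← Real.integral_rpow_mul_exp_neg_mul_Ioi ha hr, ofReal_integral_eq_lintegral_ofReal]
  · have h := integrableOn_rpow_mul_exp_neg_mul_rpow (p := 1) (s := a - 1) (b := r)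
      (by linarith) one_pos hr
    simpa only [Real.rpow_one, neg_mul] using! h
  · filter_upwards [ae_restrict_mem measurableSet_Ioi] with t ht
    have : (0 : ℝ) < t := ht
    positivity

theorem lintegral_exp_neg_mul_sq_norm {V : Type*} [NormedAddCommGroup V] [InnerProductSpace ℝ V]
    [FiniteDimensional ℝ V] [MeasurableSpace V] [BorelSpace V] {b : ℝ} (hb : 0 < b) :
    ∫⁻ v : V, ENNReal.ofReal (Real.exp (-b * ‖v‖ ^ 2)) =
      ENNReal.ofReal ((Real.pi / b) ^ (Module.finrank ℝ V / 2 : ℝ)) := by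
  have hI : ∫ v : V, Real.exp (-b * ‖v‖ ^ 2) = (Real.pi / b) ^ (Module.finrank ℝ V / 2 : ℝ) :=
    GaussianFourier.integral_rexp_neg_mul_sq_norm hb
  rw [← hI, ofReal_integral_eq_lintegral_ofReal]
  -- The Bochner integral of a nonintegrable function is zero, but the value here is positive.
  · by_contra h
    rw [integral_undef h] at hI
    have : 0 < (Real.pi / b) ^ (Module.finrank ℝ V / 2 : ℝ) := by positivity
    exact this.ne hI
  · exact Eventually.of_forall fun v => (Real.exp_pos _).le

/-- Completing the square in $y$ leaves a Gaussian of parameter $t+r$ centred at $\frac{t}{t+r}x$;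
translation invariance recentres it. -/
theorem lintegral_exp_neg_mul_sq_norm_sub_mul_exp {V : Type*} [NormedAddCommGroup V]
    [InnerProductSpace ℝ V] [FiniteDimensional ℝ V] [MeasurableSpace V] [BorelSpace V]
    {t r : ℝ} (ht : 0 < t) (hr : 0 < r) (x : V) :
    ∫⁻ y : V, ENNReal.ofReal (Real.exp (-(‖x - y‖ ^ 2 * t)) * Real.exp (-(‖y‖ ^ 2 * r))) =
      ENNReal.ofReal ((Real.pi / (t + r)) ^ (Module.finrank ℝ V / 2 : ℝ) *
        Real.exp (-(t * r / (t + r) * ‖x‖ ^ 2))) := by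
  have htr : 0 < t + r := by positivity
  have h (y : V) : Real.exp (-(‖x - y‖ ^ 2 * t)) * Real.exp (-(‖y‖ ^ 2 * r)) =
      Real.exp (-(t * r / (t + r) * ‖x‖ ^ 2)) *
        Real.exp (-(t + r) * ‖y - (t / (t + r)) • x‖ ^ 2) := by
    rw [← Real.exp_add, ← Real.exp_add, norm_sub_sq_real, norm_sub_sq_real, norm_smul,
      inner_smul_right, real_inner_comm, Real.norm_eq_abs, abs_of_pos (by positivity)]
    congr 1
    field_simp
    ring
  simp_rw [h, ENNReal.ofReal_mul (Real.exp_pos _).le]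
  rw [lintegral_const_mul _ (by fun_prop),
    lintegral_sub_right_eq_self (fun y : V => ENNReal.ofReal (Real.exp (-(t + r) * ‖y‖ ^ 2))),
    lintegral_exp_neg_mul_sq_norm htr, mul_comm, ENNReal.ofReal_mul (by positivity)]

theorem lintegral_Ioi_comp_mul_left {t : ℝ} (ht : 0 < t) (f : ℝ → ENNReal) :
    ∫⁻ r in Set.Ioi (0 : ℝ), f r = ENNReal.ofReal t * ∫⁻ v in Set.Ioi (0 : ℝ), f (t * v) := by
  have himg : (fun v => t * v) '' Set.Ioi (0 : ℝ) = Set.Ioi 0 := by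
    rw [Set.image_mul_left_Ioi ht, mul_zero]
  have h := lintegral_image_eq_lintegral_abs_deriv_mul (s := Set.Ioi (0 : ℝ))
    (f := fun v => t * v) (f' := fun _ => t) measurableSet_Ioi
    (fun v _ => by simpa using ((hasDerivAt_id v).const_mul t).hasDerivWithinAt)
    (mul_right_injective₀ ht.ne').injOn f
  rw [himg] at h
  rw [h, lintegral_const_mul' _ _ ENNReal.ofReal_ne_top, abs_of_pos ht]

/-- The Beta integral of the second kind. -/
theorem lintegral_rpow_mul_one_add_rpow {a b : ℝ} (ha : 0 < a) (hb : 0 < b) :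
    ∫⁻ v in Set.Ioi (0 : ℝ), ENNReal.ofReal (v ^ (a - 1) * (1 / (1 + v)) ^ (a + b)) =
      ENNReal.ofReal (Real.Gamma a * Real.Gamma b / Real.Gamma (a + b)) := by
  have hab := Real.Gamma_pos_of_pos (add_pos ha hb)
  have hΓa := Real.Gamma_pos_of_pos ha
  have hΓb := Real.Gamma_pos_of_pos hb
  -- $\Gamma(a+b)(1+v)^{-(a+b)}$ is itself a Gamma integral in $t$; in the other order the double
  -- integral splits into $\Gamma(a)\Gamma(b)$.
  have h1 : ENNReal.ofReal (Real.Gamma (a + b)) *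
      ∫⁻ v in Set.Ioi (0 : ℝ), ENNReal.ofReal (v ^ (a - 1) * (1 / (1 + v)) ^ (a + b)) =
      ∫⁻ v in Set.Ioi (0 : ℝ), ∫⁻ t in Set.Ioi (0 : ℝ), ENNReal.ofReal
        (v ^ (a - 1) * (t ^ (a + b - 1) * Real.exp (-((1 + v) * t)))) := by
    rw [← lintegral_const_mul' _ _ ENNReal.ofReal_ne_top]
    refine setLIntegral_congr_fun measurableSet_Ioi fun v (hv : 0 < v) => ?_
    simp_rw [ENNReal.ofReal_mul (Real.rpow_nonneg hv.le _)]
    rw [lintegral_const_mul' _ _ ENNReal.ofReal_ne_top,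
      lintegral_rpow_mul_exp_neg_mul_Ioi (add_pos ha hb) (by positivity),
      ENNReal.ofReal_mul (by positivity : (0 : ℝ) ≤ (1 / (1 + v)) ^ (a + b))]
    ring
  have h2 : ∫⁻ v in Set.Ioi (0 : ℝ), ∫⁻ t in Set.Ioi (0 : ℝ), ENNReal.ofReal
        (v ^ (a - 1) * (t ^ (a + b - 1) * Real.exp (-((1 + v) * t)))) =
      ENNReal.ofReal (Real.Gamma a * Real.Gamma b) := by
    rw [lintegral_lintegral_swap (by unfold Function.uncurry; fun_prop)]
    have h3 : ∀ t ∈ Set.Ioi (0 : ℝ), ∫⁻ v in Set.Ioi (0 : ℝ), ENNReal.ofReal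
        (v ^ (a - 1) * (t ^ (a + b - 1) * Real.exp (-((1 + v) * t)))) =
        ENNReal.ofReal (Real.Gamma a) *
          ENNReal.ofReal (t ^ (b - 1) * Real.exp (-(1 * t))) := by
      intro t (ht : 0 < t)
      have h4 (v : ℝ) : v ^ (a - 1) * (t ^ (a + b - 1) * Real.exp (-((1 + v) * t))) =
          (t ^ (a + b - 1) * Real.exp (-t)) * (v ^ (a - 1) * Real.exp (-(t * v))) := by
        rw [show -((1 + v) * t) = -t + -(t * v) by ring, Real.exp_add]
        ring
      simp_rw [h4, ENNReal.ofReal_mul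
        (by positivity : 0 ≤ t ^ (a + b - 1) * Real.exp (-t))]
      rw [lintegral_const_mul' _ _ ENNReal.ofReal_ne_top,
        lintegral_rpow_mul_exp_neg_mul_Ioi ha ht, ← ENNReal.ofReal_mul (by positivity),
        ← ENNReal.ofReal_mul (by positivity)]
      congr 1
      rw [one_div, Real.inv_rpow ht.le, show b - 1 = a + b - 1 - a by ring,
        Real.rpow_sub ht _ a, one_mul]
      ring
    rw [setLIntegral_congr_fun measurableSet_Ioi h3,
      lintegral_const_mul' _ _ ENNReal.ofReal_ne_top,
      lintegral_rpow_mul_exp_neg_mul_Ioi hb one_pos, ← ENNReal.ofReal_mul (by positivity)]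
    simp
  rw [h2] at h1
  rw [ENNReal.ofReal_div_of_pos hab, ENNReal.eq_div_iff (by simpa using hab)
    ENNReal.ofReal_ne_top, h1]

/-- Substituting $r=tv$ makes the $t$-integral a Gamma integral of order $c=a+b-d$. Its value
carries $((1+v)/(vR))^c$, which leaves a Beta integral in $v$ with parameters $d-a$ and $d-b$. The
three inequalities are the positivity of these orders. -/
theorem lintegral_lintegral_rpow_mul_exp {a b d R : ℝ} (had : a < d) (hbd : b < d)
    (habd : d < a + b) (hR : 0 < R) :
    ∫⁻ t in Set.Ioi (0 : ℝ), ∫⁻ r in Set.Ioi (0 : ℝ), ENNReal.ofReal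
        (t ^ (a - 1) * r ^ (b - 1) *
          ((Real.pi / (t + r)) ^ d * Real.exp (-(t * r / (t + r) * R)))) =
      ENNReal.ofReal (Real.pi ^ d * Real.Gamma (a + b - d) * Real.Gamma (d - a) *
        Real.Gamma (d - b) / Real.Gamma (2 * d - a - b) * (1 / R) ^ (a + b - d)) := by
  set c := a + b - d with hc
  have hc0 : 0 < c := by linarith
  have hΓc := Real.Gamma_pos_of_pos hc0
  calc
    _ = ∫⁻ t in Set.Ioi (0 : ℝ), ∫⁻ v in Set.Ioi (0 : ℝ), ENNReal.ofReal
        (Real.pi ^ d * v ^ (b - 1) * (1 / (1 + v)) ^ d *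
          (t ^ (c - 1) * Real.exp (-(v / (1 + v) * R * t)))) := by
      refine setLIntegral_congr_fun measurableSet_Ioi fun t (ht : 0 < t) => ?_
      rw [lintegral_Ioi_comp_mul_left ht, ← lintegral_const_mul' _ _ ENNReal.ofReal_ne_top]
      refine setLIntegral_congr_fun measurableSet_Ioi fun v (hv : 0 < v) => ?_
      rw [← ENNReal.ofReal_mul ht.le]
      congr 1
      have e1 : t * (t * v) / (t + t * v) * R = v / (1 + v) * R * t := by
        field_simp
      have e2 : Real.pi / (t + t * v) = Real.pi * (1 / (1 + v)) * t⁻¹ := by field_simp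
      rw [e1, e2, Real.mul_rpow ht.le hv.le, Real.mul_rpow (by positivity) (by positivity),
        Real.mul_rpow (by positivity) (by positivity), Real.inv_rpow ht.le,
        show c - 1 = 1 + (a - 1) + (b - 1) - d by rw [hc]; ring, Real.rpow_sub ht _ d,
        Real.rpow_add ht _ (b - 1), Real.rpow_add ht, Real.rpow_one]
      ring
    _ = ∫⁻ v in Set.Ioi (0 : ℝ), ENNReal.ofReal (Real.pi ^ d * Real.Gamma c * (1 / R) ^ c) *
        ENNReal.ofReal (v ^ (d - a - 1) * (1 / (1 + v)) ^ (d - a + (d - b))) := by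
      rw [lintegral_lintegral_swap (by unfold Function.uncurry; fun_prop)]
      refine setLIntegral_congr_fun measurableSet_Ioi fun v (hv : 0 < v) => ?_
      simp_rw [ENNReal.ofReal_mul
        (by positivity : 0 ≤ Real.pi ^ d * v ^ (b - 1) * (1 / (1 + v)) ^ d)]
      rw [lintegral_const_mul' _ _ ENNReal.ofReal_ne_top,
        lintegral_rpow_mul_exp_neg_mul_Ioi hc0 (by positivity),
        ← ENNReal.ofReal_mul (by positivity), ← ENNReal.ofReal_mul (by positivity)]
      congr 1
      have e1 : 1 / (v / (1 + v) * R) = (1 / R) * v⁻¹ * (1 / (1 + v))⁻¹ := by field_simp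
      rw [e1, Real.mul_rpow (by positivity) (by positivity),
        Real.mul_rpow (by positivity) (by positivity), Real.inv_rpow hv.le,
        Real.inv_rpow (by positivity), show d - a - 1 = b - 1 - c by rw [hc]; ring,
        show d - a + (d - b) = d - c by rw [hc]; ring, Real.rpow_sub hv (b - 1) c,
        Real.rpow_sub (by positivity) d c]
      ring
    _ = _ := by
      rw [lintegral_const_mul' _ _ ENNReal.ofReal_ne_top,
        lintegral_rpow_mul_one_add_rpow (by linarith) (by linarith),
        ← ENNReal.ofReal_mul (by positivity), show d - a + (d - b) = 2 * d - a - b by ring]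
      congr 1
      ring

theorem lintegral_inv_sq_norm_rpow_mul {V : Type*} [NormedAddCommGroup V]
    [InnerProductSpace ℝ V] [FiniteDimensional ℝ V] [MeasurableSpace V] [BorelSpace V]
    {a b d : ℝ} (hd : d = Module.finrank ℝ V / 2) (ha : 0 < a) (hb : 0 < b) (had : a < d)
    (hbd : b < d) (habd : d < a + b) {x : V} (hx : x ≠ 0) :
    ∫⁻ y : V, ENNReal.ofReal ((1 / ‖x - y‖ ^ 2) ^ a * (1 / ‖y‖ ^ 2) ^ b) =
      ENNReal.ofReal (Real.pi ^ d * Real.Gamma (a + b - d) * Real.Gamma (d - a) *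
        Real.Gamma (d - b) / (Real.Gamma a * Real.Gamma b * Real.Gamma (2 * d - a - b)) *
        (1 / ‖x‖ ^ 2) ^ (a + b - d)) := by
  have hΓa := Real.Gamma_pos_of_pos ha
  have hΓb := Real.Gamma_pos_of_pos hb
  have hV : Nontrivial V := ⟨x, 0, hx⟩
  -- The Gamma representation of the two powers needs both norms to be positive.
  have hae : ∀ᵐ y : V, y ≠ 0 ∧ y ≠ x :=
    (Measure.ae_ne volume 0).and (Measure.ae_ne volume x)
  have key : ENNReal.ofReal (Real.Gamma a * Real.Gamma b) *
      ∫⁻ y : V, ENNReal.ofReal ((1 / ‖x - y‖ ^ 2) ^ a * (1 / ‖y‖ ^ 2) ^ b) =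
      ENNReal.ofReal (Real.pi ^ d * Real.Gamma (a + b - d) * Real.Gamma (d - a) *
        Real.Gamma (d - b) / Real.Gamma (2 * d - a - b) * (1 / ‖x‖ ^ 2) ^ (a + b - d)) := by
    have hx' : 0 < ‖x‖ := norm_pos_iff.2 hx
    rw [← lintegral_lintegral_rpow_mul_exp had hbd habd (by positivity),
      ← lintegral_const_mul' _ _ ENNReal.ofReal_ne_top]
    calc
      _ = ∫⁻ y : V, ∫⁻ t in Set.Ioi (0 : ℝ), ∫⁻ r in Set.Ioi (0 : ℝ),
          ENNReal.ofReal (t ^ (a - 1) * Real.exp (-(‖x - y‖ ^ 2 * t))) *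
            ENNReal.ofReal (r ^ (b - 1) * Real.exp (-(‖y‖ ^ 2 * r))) := by
        refine lintegral_congr_ae ?_
        filter_upwards [hae] with y hy
        have h1 : 0 < ‖y‖ := norm_pos_iff.2 hy.1
        have h2 : 0 < ‖x - y‖ := norm_pos_iff.2 (sub_ne_zero.2 hy.2.symm)
        simp_rw [lintegral_const_mul' _ _ ENNReal.ofReal_ne_top]
        rw [lintegral_mul_const' _ _ (by
            rw [lintegral_rpow_mul_exp_neg_mul_Ioi hb (by positivity)]
            exact ENNReal.ofReal_ne_top),
          lintegral_rpow_mul_exp_neg_mul_Ioi hb (by positivity),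
          lintegral_rpow_mul_exp_neg_mul_Ioi ha (by positivity),
          ← ENNReal.ofReal_mul (by positivity), ← ENNReal.ofReal_mul (by positivity)]
        congr 1
        ring
      _ = ∫⁻ t in Set.Ioi (0 : ℝ), ∫⁻ y : V, ∫⁻ r in Set.Ioi (0 : ℝ),
          ENNReal.ofReal (t ^ (a - 1) * Real.exp (-(‖x - y‖ ^ 2 * t))) *
            ENNReal.ofReal (r ^ (b - 1) * Real.exp (-(‖y‖ ^ 2 * r))) := by
        refine lintegral_lintegral_swap (Measurable.aemeasurable ?_)
        unfold Function.uncurry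
        refine Measurable.lintegral_prod_right ?_
        fun_prop
      _ = ∫⁻ t in Set.Ioi (0 : ℝ), ∫⁻ r in Set.Ioi (0 : ℝ), ∫⁻ y : V,
          ENNReal.ofReal (t ^ (a - 1) * Real.exp (-(‖x - y‖ ^ 2 * t))) *
            ENNReal.ofReal (r ^ (b - 1) * Real.exp (-(‖y‖ ^ 2 * r))) := by
        refine lintegral_congr fun t => ?_
        exact lintegral_lintegral_swap (by unfold Function.uncurry; fun_prop)
      _ = _ := by
        refine setLIntegral_congr_fun measurableSet_Ioi fun t (ht : 0 < t) => ?_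
        refine setLIntegral_congr_fun measurableSet_Ioi fun r (hr : 0 < r) => ?_
        rw [ENNReal.ofReal_mul (by positivity : 0 ≤ t ^ (a - 1) * r ^ (b - 1)), hd,
          ← lintegral_exp_neg_mul_sq_norm_sub_mul_exp ht hr,
          ← lintegral_const_mul' _ _ ENNReal.ofReal_ne_top]
        refine lintegral_congr fun y => ?_
        rw [← ENNReal.ofReal_mul (by positivity), ← ENNReal.ofReal_mul (by positivity)]
        congr 1
        ring
  have hpos : 0 < Real.Gamma a * Real.Gamma b := mul_pos hΓa hΓb
  rw [show ∀ A B C D E F G H : ℝ, A * B * C * D / (E * F * G) * H =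
      A * B * C * D / G * H / (E * F) by intros; field_simp,
    ENNReal.ofReal_div_of_pos hpos, ENNReal.eq_div_iff (by simpa using hpos)
      ENNReal.ofReal_ne_top, key]

/-! ### Integration by parts off the origin; classical solutions are weak -/

theorem volume_restrict_compl_zero {N : ℕ} (hN : 0 < N) :
    (volume : Measure (EuclideanSpace ℝ (Fin N))).restrict {0}ᶜ = volume := by
  have : Nonempty (Fin N) := ⟨⟨0, hN⟩⟩
  exact Measure.restrict_eq_self_of_ae_mem (Measure.ae_ne volume 0)

/-- A function continuous off the origin times a continuous function compactly supported off the
origin is integrable. -/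
theorem integrable_mul_of_tsupport_subset {N : ℕ} {v ψ : EuclideanSpace ℝ (Fin N) → ℝ}
    (hv : ContinuousOn v {0}ᶜ) (hψ : Continuous ψ) (hc : HasCompactSupport ψ)
    (hs : tsupport ψ ⊆ {0}ᶜ) : Integrable (fun x => v x * ψ x) := by
  refine Continuous.integrable_of_hasCompactSupport ?_ hc.mul_left
  refine continuous_of_tsupport fun x hx => ?_
  have hx0 : x ∈ ({0}ᶜ : Set (EuclideanSpace ℝ (Fin N))) := hs (tsupport_mul_subset_right hx)
  exact (hv.continuousAt (isOpen_compl_singleton.mem_nhds hx0)).mul hψ.continuousAt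

theorem IsTestFunction.continuous_fderiv_apply {N : ℕ} {φ : EuclideanSpace ℝ (Fin N) → ℝ}
    (hφ : IsTestFunction N φ) (e : EuclideanSpace ℝ (Fin N)) :
    Continuous fun x => fderiv ℝ φ x e :=
  (hφ.contDiff.continuous_fderiv (by simp)).clm_apply continuous_const

theorem IsTestFunction.tsupport_fderiv_apply_subset {N : ℕ} {φ : EuclideanSpace ℝ (Fin N) → ℝ}
    (hφ : IsTestFunction N φ) (e : EuclideanSpace ℝ (Fin N)) :
    tsupport (fun x => fderiv ℝ φ x e) ⊆ {0}ᶜ :=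
  (_root_.tsupport_fderiv_apply_subset ℝ e).trans hφ.tsupport_subset

theorem IsTestFunction.integrable_mul {N : ℕ} {v φ : EuclideanSpace ℝ (Fin N) → ℝ}
    (hφ : IsTestFunction N φ) (hv : ContinuousOn v {0}ᶜ) : Integrable (fun x => v x * φ x) :=
  integrable_mul_of_tsupport_subset hv hφ.contDiff.continuous hφ.hasCompactSupport
    hφ.tsupport_subset

theorem IsTestFunction.integrable_mul_fderiv {N : ℕ} {v φ : EuclideanSpace ℝ (Fin N) → ℝ}
    (hφ : IsTestFunction N φ) (hv : ContinuousOn v {0}ᶜ) (e : EuclideanSpace ℝ (Fin N)) :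
    Integrable (fun x => v x * fderiv ℝ φ x e) :=
  integrable_mul_of_tsupport_subset hv (hφ.continuous_fderiv_apply e)
    (hφ.hasCompactSupport.fderiv_apply ℝ e) (hφ.tsupport_fderiv_apply_subset e)

theorem ContDiffOn.fderiv_apply_compl_zero {N : ℕ} {v : EuclideanSpace ℝ (Fin N) → ℝ}
    {m n : WithTop ℕ∞} (hv : ContDiffOn ℝ n v {0}ᶜ) (hmn : m + 1 ≤ n)
    (e : EuclideanSpace ℝ (Fin N)) : ContDiffOn ℝ m (fun x => fderiv ℝ v x e) {0}ᶜ :=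
  (hv.fderiv_of_isOpen isOpen_compl_singleton hmn).clm_apply contDiffOn_const

/-- The singularity of `v` contributes no boundary term: differentiability is needed only on the
support of `φ`, and every product is continuous with compact support. -/
theorem IsTestFunction.integral_mul_fderiv {N : ℕ} {v φ : EuclideanSpace ℝ (Fin N) → ℝ}
    (hφ : IsTestFunction N φ) (hv : ContDiffOn ℝ 1 v {0}ᶜ) (e : EuclideanSpace ℝ (Fin N)) :
    ∫ x, v x * fderiv ℝ φ x e = -∫ x, fderiv ℝ v x e * φ x := by
  refine integral_mul_fderiv_eq_neg_fderiv_mul_of_integrable ?_ ?_ ?_ ?_ ?_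
  · exact hφ.integrable_mul
      (hv.fderiv_apply_compl_zero (m := 0) (by simp) e).continuousOn
  · exact hφ.integrable_mul_fderiv hv.continuousOn e
  · exact hφ.integrable_mul hv.continuousOn
  · exact fun x hx => (hv.differentiableOn one_ne_zero).differentiableAt
      (isOpen_compl_singleton.mem_nhds (hφ.tsupport_subset hx))
  · exact fun x _ => hφ.contDiff.differentiable (by simp) x

theorem inner_gradient_eq_sum {N : ℕ} (u φ : EuclideanSpace ℝ (Fin N) → ℝ)
    (x : EuclideanSpace ℝ (Fin N)) :
    inner ℝ (∇ u x) (∇ φ x) = ∑ i, fderiv ℝ u x (EuclideanSpace.basisFun (Fin N) ℝ i) *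
      fderiv ℝ φ x (EuclideanSpace.basisFun (Fin N) ℝ i) := by
  rw [← (EuclideanSpace.basisFun (Fin N) ℝ).sum_inner_mul_inner]
  refine Finset.sum_congr rfl fun i _ => ?_
  rw [real_inner_comm (∇ φ x)]
  simp only [gradient, InnerProductSpace.toDual_symm_apply]

theorem laplacian_eq_sum_fderiv_fderiv {N : ℕ} {u : EuclideanSpace ℝ (Fin N) → ℝ}
    (hu : ContDiffOn ℝ 2 u {0}ᶜ) {x : EuclideanSpace ℝ (Fin N)} (hx : x ≠ 0) :
    Δ u x = ∑ i, fderiv ℝ (fun y => fderiv ℝ u y (EuclideanSpace.basisFun (Fin N) ℝ i)) x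
      (EuclideanSpace.basisFun (Fin N) ℝ i) := by
  rw [InnerProductSpace.laplacian_eq_iteratedFDeriv_orthonormalBasis u
    (EuclideanSpace.basisFun (Fin N) ℝ)]
  refine Finset.sum_congr rfl fun i _ => ?_
  have hd : DifferentiableAt ℝ (fderiv ℝ u) x :=
    ((hu.fderiv_of_isOpen (m := 1) isOpen_compl_singleton (by norm_num)).differentiableOn
      one_ne_zero).differentiableAt (isOpen_compl_singleton.mem_nhds hx)
  rw [iteratedFDeriv_two_apply, fderiv_clm_apply hd (differentiableAt_const _)]
  simp

theorem continuousOn_laplacian {N : ℕ} {u : EuclideanSpace ℝ (Fin N) → ℝ}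
    (hu : ContDiffOn ℝ 2 u {0}ᶜ) : ContinuousOn (Δ u) {0}ᶜ := by
  refine ContinuousOn.congr ?_ fun x hx => laplacian_eq_sum_fderiv_fderiv hu hx
  exact continuousOn_finsetSum _ fun i _ => ((hu.fderiv_apply_compl_zero (m := 1)
    (by norm_num) _).fderiv_apply_compl_zero (m := 0) (by norm_num) _).continuousOn

theorem continuousOn_gradient {N : ℕ} {u : EuclideanSpace ℝ (Fin N) → ℝ}
    (hu : ContDiffOn ℝ 1 u {0}ᶜ) : ContinuousOn (∇ u) {0}ᶜ :=
  (InnerProductSpace.toDual ℝ _).symm.continuous.comp_continuousOn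
    (hu.continuousOn_fderiv_of_isOpen isOpen_compl_singleton le_rfl)

theorem IsTestFunction.integral_inner_gradient {N : ℕ} (hN : 0 < N)
    {u φ : EuclideanSpace ℝ (Fin N) → ℝ} (hφ : IsTestFunction N φ)
    (hu : ContDiffOn ℝ 2 u {0}ᶜ) :
    ∫ x, inner ℝ (∇ u x) (∇ φ x) = ∫ x, -(Δ u x) * φ x := by
  have hV : Nonempty (Fin N) := ⟨⟨0, hN⟩⟩
  have hv := fun i => hu.fderiv_apply_compl_zero (m := 1) (by norm_num)
    (EuclideanSpace.basisFun (Fin N) ℝ i)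
  simp_rw [inner_gradient_eq_sum]
  rw [integral_finsetSum _ fun i _ => hφ.integrable_mul_fderiv (hv i).continuousOn _]
  simp_rw [fun i => hφ.integral_mul_fderiv (hv i) (EuclideanSpace.basisFun (Fin N) ℝ i)]
  rw [Finset.sum_neg_distrib, ← integral_finsetSum _ fun i _ => hφ.integrable_mul
    ((hv i).fderiv_apply_compl_zero (m := 0) (by norm_num) _).continuousOn, ← integral_neg]
  refine integral_congr_ae ?_
  filter_upwards [Measure.ae_ne volume (0 : EuclideanSpace ℝ (Fin N))] with x hx
  rw [laplacian_eq_sum_fderiv_fderiv hu hx, ← Finset.sum_mul, neg_mul]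

theorem isWeakGradient_gradient {N : ℕ} (hN : 0 < N) {u : EuclideanSpace ℝ (Fin N) → ℝ}
    (hu : ContDiffOn ℝ 1 u {0}ᶜ) : IsWeakGradient N u (∇ u) where
  locallyIntegrableOn :=
    hu.continuousOn.locallyIntegrableOn (measurableSet_singleton 0).compl
  locallyIntegrableOn_grad :=
    (continuousOn_gradient hu).locallyIntegrableOn (measurableSet_singleton 0).compl
  integral_eq φ hφ := by
    rw [volume_restrict_compl_zero hN]
    have h1 : Integrable fun x => u x • ∇ φ x := by
      refine Integrable.of_eval_piLp fun i => ?_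
      convert hφ.integrable_mul_fderiv hu.continuousOn
        (EuclideanSpace.basisFun (Fin N) ℝ i) using 2 with x
      rw [← InnerProductSpace.toDual_symm_apply, EuclideanSpace.basisFun_apply,
        EuclideanSpace.inner_single_right]
      simp [gradient]
    have h2 : Integrable fun x => φ x • ∇ u x := by
      refine Integrable.of_eval_piLp fun i => ?_
      convert hφ.integrable_mul (hu.fderiv_apply_compl_zero (m := 0) (by simp)
        (EuclideanSpace.basisFun (Fin N) ℝ i)).continuousOn using 2 with x
      rw [← InnerProductSpace.toDual_symm_apply, EuclideanSpace.basisFun_apply,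
        EuclideanSpace.inner_single_right]
      simp [gradient, mul_comm]
    -- Pairing with a fixed vector reduces the vector identity to integration by parts along `e`.
    refine ext_inner_left ℝ fun e => ?_
    rw [inner_neg_right, ← integral_inner h1, ← integral_inner h2]
    simp_rw [inner_smul_right, real_inner_comm _ e, gradient,
      InnerProductSpace.toDual_symm_apply]
    rw [hφ.integral_mul_fderiv hu e]
    simp_rw [mul_comm]

theorem IsClassicalSolution.isWeakSolution {N : ℕ} (hN : 0 < N) {μ p q : ℝ}
    {u : EuclideanSpace ℝ (Fin N) → ℝ} (hu : IsClassicalSolution N μ p q u) :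
    IsWeakSolution N μ p q u := by
  have hV : Nonempty (Fin N) := ⟨⟨0, hN⟩⟩
  have hu1 : ContDiffOn ℝ 1 u {0}ᶜ := hu.contDiffOn.of_le (by norm_num)
  have hms : MeasurableSet ({0}ᶜ : Set (EuclideanSpace ℝ (Fin N))) :=
    (measurableSet_singleton 0).compl
  refine ⟨hu.contDiffOn.continuousOn, hu.converges, ?_, ∇ u, isWeakGradient_gradient hN hu1,
    ((continuousOn_gradient hu1).norm.pow 2).locallyIntegrableOn hms, fun φ hφ => ?_⟩
  -- No estimate of the nonlocal term is needed: by the equation the right-hand side equals $-\Delta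
  -- u$, which is continuous off the origin.
  · refine ContinuousOn.locallyIntegrableOn ?_ hms
    exact (continuousOn_laplacian hu.contDiffOn).neg.congr fun x hx => (hu.equation x hx).symm
  · rw [volume_restrict_compl_zero hN, hφ.integral_inner_gradient hN hu.contDiffOn]
    refine integral_congr_ae ?_
    filter_upwards [Measure.ae_ne volume (0 : EuclideanSpace ℝ (Fin N))] with x hx
    rw [hu.equation x hx]

/-! ### The Laplacian of a power of the norm -/

theorem hasFDerivAt_norm_sq_rpow {V : Type*} [NormedAddCommGroup V] [InnerProductSpace ℝ V]
    (r : ℝ) {x : V} (hx : x ≠ 0) :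
    HasFDerivAt (fun y : V => (‖y‖ ^ 2) ^ r)
      ((r * (‖x‖ ^ 2) ^ (r - 1)) • (2 • innerSL ℝ x)) x :=
  (hasStrictFDerivAt_norm_sq x).hasFDerivAt.rpow_const (Or.inl (by simpa using hx))

theorem contDiffOn_norm_sq_rpow {V : Type*} [NormedAddCommGroup V] [InnerProductSpace ℝ V]
    (r : ℝ) {n : WithTop ℕ∞} : ContDiffOn ℝ n (fun y : V => (‖y‖ ^ 2) ^ r) {0}ᶜ :=
  (contDiff_norm_sq ℝ).contDiffOn.rpow_const_of_ne fun x hx => by simpa using hx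

theorem laplacian_const_mul_norm_sq_rpow {N : ℕ} (A r : ℝ) {x : EuclideanSpace ℝ (Fin N)}
    (hx : x ≠ 0) :
    Δ (fun y : EuclideanSpace ℝ (Fin N) => A * (‖y‖ ^ 2) ^ r) x =
      A * (2 * r * (N + 2 * (r - 1))) * (‖x‖ ^ 2) ^ (r - 1) := by
  rw [laplacian_eq_sum_fderiv_fderiv (contDiffOn_const.mul (contDiffOn_norm_sq_rpow r)) hx]
  have h1 (e y : EuclideanSpace ℝ (Fin N)) (hy : y ≠ 0) :
      fderiv ℝ (fun y : EuclideanSpace ℝ (Fin N) => A * (‖y‖ ^ 2) ^ r) y e =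
        (2 * A * r) * ((‖y‖ ^ 2) ^ (r - 1) * inner ℝ y e) := by
    rw [((hasFDerivAt_norm_sq_rpow r hy).const_mul A).fderiv]
    simp
    ring
  have h2 (e : EuclideanSpace ℝ (Fin N)) :
      fderiv ℝ (fun y => fderiv ℝ (fun y : EuclideanSpace ℝ (Fin N) => A * (‖y‖ ^ 2) ^ r) y e)
        x e = (2 * A * r) * (2 * (r - 1) * (‖x‖ ^ 2) ^ (r - 1 - 1) * (inner ℝ x e * inner ℝ e x) +
          (‖x‖ ^ 2) ^ (r - 1) * ‖e‖ ^ 2) := by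
    have hev : (fun y => fderiv ℝ (fun y : EuclideanSpace ℝ (Fin N) => A * (‖y‖ ^ 2) ^ r) y e)
        =ᶠ[𝓝 x] fun y => (2 * A * r) * ((‖y‖ ^ 2) ^ (r - 1) * inner ℝ y e) := by
      filter_upwards [isOpen_compl_singleton.mem_nhds hx] with y hy using h1 e y hy
    have hi : HasFDerivAt (fun y : EuclideanSpace ℝ (Fin N) => inner ℝ y e) (innerSL ℝ e) x := by
      simpa [real_inner_comm] using (innerSL ℝ e).hasFDerivAt (x := x)
    rw [hev.fderiv_eq,
      (((hasFDerivAt_norm_sq_rpow (r - 1) hx).fun_mul hi).const_mul (2 * A * r)).fderiv]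
    simp [real_inner_comm]
    ring
  simp_rw [h2]
  -- Parseval turns the sum of squared coordinates into $\|x\|^2$, which raises the exponent $r-2$
  -- to $r-1$.
  rw [← Finset.mul_sum, Finset.sum_add_distrib, ← Finset.mul_sum,
    OrthonormalBasis.sum_inner_mul_inner, real_inner_self_eq_norm_sq,
    show r - 1 = r - 1 - 1 + 1 by ring, Real.rpow_add_one (by simpa using hx)]
  simp
  ring

/-! ### Riesz constants and composition of Riesz kernels -/

theorem rieszGamma_pos {N : ℕ} {α : ℝ} (h₀ : 0 < α) (hN : α < N) : 0 < rieszGamma N α := by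
  have h1 := Real.Gamma_pos_of_pos (half_pos h₀)
  have h2 := Real.Gamma_pos_of_pos (half_pos (sub_pos.2 hN))
  unfold rieszGamma
  positivity

/-- The powers of 2 cancel, leaving the constant of `lintegral_inv_sq_norm_rpow_mul` with
$a=(N-\alpha)/2$, $b=(N-\beta)/2$, $d=N/2$. -/
theorem rieszGamma_mul_div {N : ℕ} {α β : ℝ} (hα : 0 < α) (hβ : 0 < β) (hN : α + β < N) :
    rieszGamma N α * rieszGamma N β / rieszGamma N (α + β) =
      Real.pi ^ ((N : ℝ) / 2) * Real.Gamma ((N - α - β) / 2) * Real.Gamma (α / 2) *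
        Real.Gamma (β / 2) / (Real.Gamma ((N - α) / 2) * Real.Gamma ((N - β) / 2) *
          Real.Gamma ((α + β) / 2)) := by
  have h1 := Real.Gamma_pos_of_pos (show 0 < ((N : ℝ) - α) / 2 by linarith)
  have h2 := Real.Gamma_pos_of_pos (show 0 < ((N : ℝ) - β) / 2 by linarith)
  have h3 := Real.Gamma_pos_of_pos (show 0 < (α + β) / 2 by linarith)
  have h4 := Real.Gamma_pos_of_pos (show 0 < ((N : ℝ) - α - β) / 2 by linarith)
  have hπ : 0 < Real.pi ^ ((N : ℝ) / 2) := by positivity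
  unfold rieszGamma
  rw [Real.rpow_add two_pos, show (N : ℝ) - (α + β) = N - α - β by ring]
  field_simp

/-- The composition of two Riesz kernels on `ℝ^N`: convergence and value. -/
theorem riesz_composition {N : ℕ} {α β : ℝ} (hα : 0 < α) (hβ : 0 < β) (hN : α + β < N)
    {x : EuclideanSpace ℝ (Fin N)} (hx : x ≠ 0) :
    Integrable (fun y : EuclideanSpace ℝ (Fin N) =>
      (1 / ‖x - y‖ ^ 2) ^ (((N : ℝ) - α) / 2) * (1 / ‖y‖ ^ 2) ^ (((N : ℝ) - β) / 2)) ∧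
    ∫ y : EuclideanSpace ℝ (Fin N),
      (1 / ‖x - y‖ ^ 2) ^ (((N : ℝ) - α) / 2) * (1 / ‖y‖ ^ 2) ^ (((N : ℝ) - β) / 2) =
      rieszGamma N α * rieszGamma N β / rieszGamma N (α + β) *
        (1 / ‖x‖ ^ 2) ^ (((N : ℝ) - α - β) / 2) := by
  have h := lintegral_inv_sq_norm_rpow_mul (V := EuclideanSpace ℝ (Fin N)) (d := (N : ℝ) / 2)
    (a := ((N : ℝ) - α) / 2) (b := ((N : ℝ) - β) / 2) (by simp) (by linarith) (by linarith)
    (by linarith) (by linarith) (by linarith) hx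
  rw [show ((N : ℝ) - α) / 2 + ((N : ℝ) - β) / 2 - (N : ℝ) / 2 = ((N : ℝ) - α - β) / 2 by ring,
    show (N : ℝ) / 2 - ((N : ℝ) - α) / 2 = α / 2 by ring,
    show (N : ℝ) / 2 - ((N : ℝ) - β) / 2 = β / 2 by ring,
    show 2 * ((N : ℝ) / 2) - ((N : ℝ) - α) / 2 - ((N : ℝ) - β) / 2 = (α + β) / 2 by ring,
    ← rieszGamma_mul_div hα hβ hN] at h
  have h0 (y : EuclideanSpace ℝ (Fin N)) : 0 ≤
      (1 / ‖x - y‖ ^ 2) ^ (((N : ℝ) - α) / 2) * (1 / ‖y‖ ^ 2) ^ (((N : ℝ) - β) / 2) := by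
    positivity
  have hm : AEStronglyMeasurable (fun y : EuclideanSpace ℝ (Fin N) =>
      (1 / ‖x - y‖ ^ 2) ^ (((N : ℝ) - α) / 2) * (1 / ‖y‖ ^ 2) ^ (((N : ℝ) - β) / 2)) :=
    Measurable.aestronglyMeasurable (by fun_prop)
  refine ⟨⟨hm, (hasFiniteIntegral_iff_ofReal (Eventually.of_forall h0)).2 ?_⟩, ?_⟩
  · rw [h]
    exact ENNReal.ofReal_lt_top
  · rw [integral_eq_lintegral_of_nonneg_ae (Eventually.of_forall h0) hm, h,
      ENNReal.toReal_ofReal]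
    have h1 := rieszGamma_pos hα (by linarith : α < N)
    have h2 := rieszGamma_pos hβ (by linarith : β < N)
    have h3 := rieszGamma_pos (add_pos hα hβ) hN
    positivity

/-! ### The power function as a solution -/

theorem abs_const_mul_norm_sq_rpow_rpow {V : Type*} [NormedAddCommGroup V] {A : ℝ} (hA : 0 < A)
    (s r : ℝ) (y : V) :
    |A * (‖y‖ ^ 2) ^ (-(s / 2))| ^ r = A ^ r * (1 / ‖y‖ ^ 2) ^ (s * r / 2) := by
  rw [abs_of_nonneg (by positivity), Real.mul_rpow hA.le (by positivity),
    ← Real.rpow_mul (by positivity), one_div, Real.inv_rpow (by positivity),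
    ← Real.rpow_neg (by positivity)]
  congr 2
  ring

theorem nonlocal_integrand_eq {V : Type*} [NormedAddCommGroup V] {A : ℝ} (hA : 0 < A)
    (s p μ : ℝ) (x y : V) :
    |A * (‖y‖ ^ 2) ^ (-(s / 2))| ^ p / ‖x - y‖ ^ μ =
      A ^ p * ((1 / ‖x - y‖ ^ 2) ^ (μ / 2) * (1 / ‖y‖ ^ 2) ^ (s * p / 2)) := by
  rw [abs_const_mul_norm_sq_rpow_rpow hA, one_div (‖x - y‖ ^ 2), Real.inv_rpow (by positivity),
    ← Real.rpow_natCast ‖x - y‖ 2, ← Real.rpow_mul (norm_nonneg _),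
    show ((2 : ℕ) : ℝ) * (μ / 2) = μ by push_cast; ring]
  ring

/-- This is `riesz_composition` with $\alpha=N-\mu$ and $\beta=N-sp$; the hypothesis `h` says
$\alpha+\beta<N$, which is convergence at infinity. -/
theorem nonlocalTerm_power {N : ℕ} {A s p μ : ℝ} (hA : 0 < A) (hμN : μ < N) (hsp : s * p < N)
    (h : (N : ℝ) < μ + s * p) :
    NonlocalTermConverges N μ p (fun y => A * (‖y‖ ^ 2) ^ (-(s / 2))) ∧
    ∀ x : EuclideanSpace ℝ (Fin N), x ≠ 0 →
      nonlocalTerm N μ p (fun y => A * (‖y‖ ^ 2) ^ (-(s / 2))) x =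
        A ^ p * (rieszGamma N (N - μ) * rieszGamma N (N - s * p) /
          rieszGamma N (N - μ + (N - s * p))) *
          (1 / ‖x‖ ^ 2) ^ ((μ + s * p - N) / 2) := by
  have key {x : EuclideanSpace ℝ (Fin N)} (hx : x ≠ 0) :=
    riesz_composition (sub_pos.2 hμN) (sub_pos.2 hsp) (by linarith) hx
  simp only [sub_sub_cancel] at key
  refine ⟨fun x hx => ?_, fun x hx => ?_⟩
  · simp_rw [nonlocal_integrand_eq hA]
    exact ((key hx).1.const_mul _).integrableOn
  · have hN : 0 < N := by
      rcases Nat.eq_zero_or_pos N with rfl | h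
      · exact absurd (Subsingleton.elim x 0) hx
      · exact h
    unfold nonlocalTerm
    simp_rw [nonlocal_integrand_eq hA]
    rw [volume_restrict_compl_zero hN, integral_const_mul, (key hx).2,
      show μ - ((N : ℝ) - s * p) = μ + s * p - N by ring, mul_assoc]

theorem tendsto_const_mul_norm_sq_rpow_neg_atTop {V : Type*} [NormedAddCommGroup V] {A r : ℝ}
    (hA : 0 < A) (hr : r < 0) :
    Tendsto (fun y : V => A * (‖y‖ ^ 2) ^ r) (𝓝[≠] 0) atTop := by
  refine Tendsto.const_mul_atTop hA ((tendsto_rpow_neg_nhdsGT_zero hr).comp ?_)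
  refine tendsto_nhdsWithin_iff.2 ⟨?_, ?_⟩
  · have h : Tendsto (fun y : V => ‖y‖ ^ 2) (𝓝 0) (𝓝 (‖(0 : V)‖ ^ 2)) :=
      (continuous_norm.pow 2).tendsto 0
    rw [norm_zero, zero_pow two_ne_zero] at h
    exact h.mono_left nhdsWithin_le_nhds
  · filter_upwards [self_mem_nhdsWithin] with y hy
    have : 0 < ‖y‖ := norm_pos_iff.2 hy
    exact Set.mem_Ioi.2 (by positivity)

theorem isClassicalSolution_power {N : ℕ} {A s p q μ : ℝ} (hA : 0 < A) (hμN : μ < N)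
    (hsp : s * p < N) (h : (N : ℝ) < μ + s * p) (hs : s * (p + q - 1) = N - μ + 2)
    (hAK : A ^ (p + q - 1) = s * ((N : ℝ) - 2 - s) * rieszGamma N ((N : ℝ) - 2 + s * (q - 1)) /
      (rieszGamma N ((N : ℝ) - μ) * rieszGamma N ((N : ℝ) - s * p))) :
    IsClassicalSolution N μ p q (fun y => A * (‖y‖ ^ 2) ^ (-(s / 2))) where
  contDiffOn := contDiffOn_const.mul (contDiffOn_norm_sq_rpow _)
  converges := (nonlocalTerm_power hA hμN hsp h).1
  equation x hx := by
    have hx' : 0 < 1 / ‖x‖ ^ 2 := by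
      have := norm_pos_iff.2 hx
      positivity
    have hαβ : (N : ℝ) - μ + (N - s * p) = N - 2 + s * (q - 1) := by linarith
    have h1 := rieszGamma_pos (sub_pos.2 hμN) (by linarith : (N : ℝ) - μ < N)
    have h2 := rieszGamma_pos (sub_pos.2 hsp) (by linarith : (N : ℝ) - s * p < N)
    have h3 := rieszGamma_pos (by linarith : 0 < (N : ℝ) - 2 + s * (q - 1)) (by linarith)
    -- The scaling relation `hs` matches the exponents: both sides are homogeneous of degree $-s-2$.
    have e1 : (‖x‖ ^ 2) ^ (-(s / 2) - 1) =
        (1 / ‖x‖ ^ 2) ^ ((μ + s * p - N) / 2) * (1 / ‖x‖ ^ 2) ^ (s * q / 2) := by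
      rw [← Real.rpow_add hx', one_div, Real.inv_rpow (by positivity),
        ← Real.rpow_neg (by positivity)]
      congr 1
      linarith
    have e2 : A ^ p * A ^ q = A ^ (p + q - 1) * A := by
      rw [← Real.rpow_add hA, ← Real.rpow_add_one hA.ne']
      congr 1
      ring
    rw [laplacian_const_mul_norm_sq_rpow A _ hx, (nonlocalTerm_power hA hμN hsp h).2 x hx,
      abs_const_mul_norm_sq_rpow_rpow hA, e1, hαβ,
      show ∀ B C D E F : ℝ, B * C * D * (E * F) = B * E * (C * D * F) by intros; ring, e2, hAK]
    field_simp
    ring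

theorem theorem1p2 (N : ℕ) (μ p q s : ℝ)
    (hμ₀ : 0 < μ) (hμN : μ < N) (hp : 1 ≤ p) (hq : 1 ≤ q)
    (hs : s = ((N : ℝ) - μ + 2) / (p + q - 1))
    (hsp₀ : 0 < s * p) (hspN : s * p < N)
    (hsq₀ : 2 - (N : ℝ) < s * (q - 1)) (hsq : s * (q - 1) < 2)
    (hsN : s < (N : ℝ) - 2) :
    0 < s ∧
    0 < s * ((N : ℝ) - 2 - s) * rieszGamma N ((N : ℝ) - 2 + s * (q - 1)) /
      (rieszGamma N ((N : ℝ) - μ) * rieszGamma N ((N : ℝ) - s * p)) ∧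
    ∃ A : ℝ, 0 < A ∧
      A ^ (p + q - 1) =
        s * ((N : ℝ) - 2 - s) * rieszGamma N ((N : ℝ) - 2 + s * (q - 1)) /
          (rieszGamma N ((N : ℝ) - μ) * rieszGamma N ((N : ℝ) - s * p)) ∧
      ∃ u : EuclideanSpace ℝ (Fin N) → ℝ,
        (∀ x, x ≠ 0 → u x = A / ‖x‖ ^ s) ∧
        IsRadial N u ∧
        (∀ x, x ≠ 0 → 0 < u x) ∧
        Tendsto u (𝓝[≠] 0) atTop ∧
        IsClassicalSolution N μ p q u ∧
        IsWeakSolution N μ p q u := by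
  have hpq : 0 < p + q - 1 := by linarith
  have hs₀ : 0 < s := by
    rw [hs]
    exact div_pos (by linarith) hpq
  have hs' : s * (p + q - 1) = N - μ + 2 := by rw [hs, div_mul_cancel₀ _ hpq.ne']
  have hN : 0 < N := by
    have : (0 : ℝ) < N := hμ₀.trans hμN
    exact_mod_cast this
  have h1 := rieszGamma_pos (sub_pos.2 hμN) (by linarith : (N : ℝ) - μ < N)
  have h2 := rieszGamma_pos (sub_pos.2 hspN) (by linarith : (N : ℝ) - s * p < N)
  have h3 := rieszGamma_pos (by linarith : 0 < (N : ℝ) - 2 + s * (q - 1)) (by linarith)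
  have h4 : 0 < (N : ℝ) - 2 - s := by linarith
  have hK : 0 < s * ((N : ℝ) - 2 - s) * rieszGamma N ((N : ℝ) - 2 + s * (q - 1)) /
      (rieszGamma N ((N : ℝ) - μ) * rieszGamma N ((N : ℝ) - s * p)) := by positivity
  refine ⟨hs₀, hK, _, Real.rpow_pos_of_pos hK (p + q - 1)⁻¹,
    Real.rpow_inv_rpow hK.le hpq.ne', ?_⟩
  have hA := Real.rpow_pos_of_pos hK (p + q - 1)⁻¹
  have hAK := Real.rpow_inv_rpow hK.le hpq.ne'
  generalize (s * ((N : ℝ) - 2 - s) * rieszGamma N ((N : ℝ) - 2 + s * (q - 1)) /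
      (rieszGamma N ((N : ℝ) - μ) * rieszGamma N ((N : ℝ) - s * p))) ^ (p + q - 1)⁻¹ = A
    at hA hAK ⊢
  -- By `hs'`, $sp=N-\mu+2-s(q-1)$, so `hsq` is exactly the required bound $N<\mu+sp$.
  have hcl := isClassicalSolution_power hA hμN hspN (by linarith) hs' hAK
  -- $A|x|^{-s}$ is written through $\|y\|^2$, which is smooth everywhere, so that the chain rule
  -- applies directly.
  refine ⟨fun y => A * (‖y‖ ^ 2) ^ (-(s / 2)), fun x _ => ?_, fun x y _ _ hxy => by simp only [hxy],
    fun x hx => ?_, tendsto_const_mul_norm_sq_rpow_neg_atTop hA (by linarith), hcl,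
    hcl.isWeakSolution hN⟩
  · simp only
    rw [Real.rpow_neg (by positivity), ← Real.rpow_natCast ‖x‖ 2, ← Real.rpow_mul (norm_nonneg _),
      show ((2 : ℕ) : ℝ) * (s / 2) = s by push_cast; ring, div_eq_mul_inv]
  · have := norm_pos_iff.2 hx
    positivity
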